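/- For a closed convex cone $C \subseteq \mathbb{R}^n$ let $P_C$ denote the Euclidean (nearest point) projection onto $C$, and let the statistical dimension of $C$ be $$\delta(C) = \mathbb{E}\,\|P_C(g)\|_2^2, \qquad g \sim \mathcal{N}(0, I_n).$$ For $x_0 \in \mathbb{R}^n$ with $x_0 \neq 0$ and $\theta \in [0, \pi/2]$ let $$\mathrm{circ}(x_0,\theta) = \{0\} \cup \{ z \in \mathbb{R}^n \setminus \{0\} : \angle(z, x_0) \le \theta \}$$ be the circular cone with axis $x_0$ and angle $\theta$. Then for every $n \ge 1$, every $x_0 \in \mathbb{R}^n \setminus \{0\}$ and every $\theta \in [0,\pi/2]$, the random variable $\|P_{\mathrm{circ}(x_0,\theta)}(g)\|_2^2$ is integrable and $$\delta\bigl(\mathrm{circ}(x_0,\theta)\bigr) \le n \sin^2\theta + 2.$$ -/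

import Mathlib

open MeasureTheory ProbabilityTheory

namespace ConicGeometry

variable {E : Type*} [NormedAddCommGroup E] [InnerProductSpace ℝ E]

/-- `p` is a point of `C` at minimal Euclidean distance from `x`. -/
def IsNearest (C : Set E) (x p : E) : Prop :=
  p ∈ C ∧ ∀ q ∈ C, ‖x - p‖ ≤ ‖x - q‖

/-- The metric projection `P_C x`: the nearest point of `C` to `x`. For a nonempty closed convex
set it exists and is unique, see `isNearest_metricProj` and `IsNearest.eq_metricProj`. -/
noncomputable def metricProj (C : Set E) (x : E) : E :=
  Classical.epsilon (IsNearest C x)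

/-- The circular cone with axis `x` and angle `θ`: the vectors `z` whose angle with `x` is at most
`θ`, together with the apex `0` (which makes no angle with `x`; Mathlib's `angle 0 x` is `π / 2`
by convention, so the apex has to be named). -/
def circ (x : E) (θ : ℝ) : Set E :=
  {z | z = 0 ∨ InnerProductGeometry.angle z x ≤ θ}

/-- The statistical dimension of a cone `C`: the expected squared norm of the projection of a
standard Gaussian vector onto `C`. -/
noncomputable def statDim [FiniteDimensional ℝ E] [MeasurableSpace E] [BorelSpace E]
    (C : Set E) : ℝ :=
  ∫ g, ‖metricProj C g‖ ^ 2 ∂(stdGaussian E)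

theorem isNearest_metricProj [FiniteDimensional ℝ E] {C : Set E} (hne : C.Nonempty)
    (hcl : IsClosed C) (x : E) : IsNearest C x (metricProj C x) := by
  have : ∃ p, IsNearest C x p := by
    have : ProperSpace E := FiniteDimensional.proper ℝ E
    obtain ⟨p, hp, h⟩ := hcl.exists_infDist_eq_dist hne x
    refine ⟨p, hp, fun q hq => ?_⟩
    rw [← dist_eq_norm, ← dist_eq_norm, ← h]
    exact Metric.infDist_le_dist_of_mem hq
  exact Classical.epsilon_spec this

theorem IsNearest.eq_metricProj {C : Set E} (hconv : Convex ℝ C) {x p : E}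
    (hp : IsNearest C x p) : p = metricProj C x := by
  have hq : IsNearest C x (metricProj C x) := Classical.epsilon_spec ⟨p, hp⟩
  generalize metricProj C x = q at hq
  have hm := hp.2 _ (hconv hp.1 hq.1 (by norm_num : (0 : ℝ) ≤ 1 / 2)
    (by norm_num : (0 : ℝ) ≤ 1 / 2) (by norm_num))
  have he : ‖x - p‖ = ‖x - q‖ := le_antisymm (hp.2 _ hq.1) (hq.2 _ hp.1)
  have hpar := parallelogram_law_with_norm ℝ (x - p) (x - q)
  have e1 : x - p + (x - q) = (2 : ℝ) • (x - ((1 / 2 : ℝ) • p + (1 / 2 : ℝ) • q)) := by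
    module
  have e2 : x - p - (x - q) = q - p := by abel
  rw [e1, e2, norm_smul, Real.norm_ofNat, he] at hpar
  rw [he] at hm
  have h0 : ‖q - p‖ = 0 := by
    nlinarith [norm_nonneg (q - p), norm_nonneg (x - q), mul_self_nonneg ‖q - p‖,
      mul_self_le_mul_self (norm_nonneg (x - q)) hm]
  exact (sub_eq_zero.mp (norm_eq_zero.mp h0)).symm

theorem mem_circ_iff {x z : E} (hx : x ≠ 0) {θ : ℝ} (h0 : 0 ≤ θ) (hpi : θ ≤ Real.pi) :
    z ∈ circ x θ ↔ ‖z‖ * ‖x‖ * Real.cos θ ≤ inner ℝ z x := by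
  rcases eq_or_ne z 0 with rfl | hz
  · simp [circ]
  · have hpos : 0 < ‖z‖ * ‖x‖ := mul_pos (norm_pos_iff.mpr hz) (norm_pos_iff.mpr hx)
    rw [← InnerProductGeometry.cos_angle_mul_norm_mul_norm, mul_comm _ (Real.cos θ),
      mul_le_mul_iff_left₀ hpos]
    simp only [circ, Set.mem_ofPred_eq, hz, false_or]
    exact (Real.strictAntiOn_cos.le_iff_ge ⟨h0, hpi⟩ ⟨InnerProductGeometry.angle_nonneg _ _,
      InnerProductGeometry.angle_le_pi _ _⟩).symm

theorem isClosed_circ {x : E} (hx : x ≠ 0) {θ : ℝ} (h0 : 0 ≤ θ) (hpi : θ ≤ Real.pi) :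
    IsClosed (circ x θ) := by
  have : circ x θ = {z | ‖z‖ * ‖x‖ * Real.cos θ ≤ inner ℝ z x} :=
    Set.ext fun _ => mem_circ_iff hx h0 hpi
  rw [this]
  exact isClosed_le (by fun_prop) (by fun_prop)

theorem convex_circ {x : E} (hx : x ≠ 0) {θ : ℝ} (h0 : 0 ≤ θ) (hpi : θ ≤ Real.pi / 2) :
    Convex ℝ (circ x θ) := by
  have hpi' : θ ≤ Real.pi := by linarith [Real.pi_pos]
  have hc : 0 ≤ Real.cos θ := Real.cos_nonneg_of_mem_Icc ⟨by linarith [Real.pi_pos], hpi⟩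
  intro y hy z hz a b ha hb _
  rw [mem_circ_iff hx h0 hpi'] at hy hz ⊢
  rw [inner_add_left, real_inner_smul_left, real_inner_smul_left]
  have hn : ‖a • y + b • z‖ ≤ a * ‖y‖ + b * ‖z‖ := by
    refine (norm_add_le _ _).trans ?_
    rw [norm_smul, norm_smul, Real.norm_of_nonneg ha, Real.norm_of_nonneg hb]
  have h1 := mul_le_mul_of_nonneg_right hn (mul_nonneg (norm_nonneg x) hc)
  nlinarith [mul_le_mul_of_nonneg_left hy ha, mul_le_mul_of_nonneg_left hz hb]

end ConicGeometry

namespace ConicGeometry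

section Projection

variable {E : Type*} [NormedAddCommGroup E] [InnerProductSpace ℝ E]

/-! Normalise the axis to `u` and split `g` into `t = ⟪u, g⟫` and the length `r` of its part
orthogonal to `u`. The plane estimate `sq_le_of_sector` bounds `‖P g‖ ^ 2` by a quadratic form in
`(t, r)`. Its cross term `t * r` is odd in `g`, so has mean zero; with `E t ^ 2 = 1` and `E r ^ 2 =
n - 1` this leaves `n sin² θ + cos² θ`. -/

/-- A vector minus its nearest point in a cone is orthogonal to that nearest point. -/
theorem IsNearest.inner_eq_norm_sq {C : Set E} (hC : ∀ z ∈ C, ∀ a : ℝ, 0 ≤ a → a • z ∈ C)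
    {x p : E} (hp : IsNearest C x p) : inner ℝ x p = ‖p‖ ^ 2 := by
  have key : ∀ a : ℝ, 0 ≤ a → 0 ≤ (a ^ 2 - 1) * ‖p‖ ^ 2 - 2 * (a - 1) * inner ℝ x p := by
    intro a ha
    have h := hp.2 _ (hC p hp.1 a ha)
    have h2 := pow_le_pow_left₀ (norm_nonneg _) h 2
    rw [norm_sub_sq_real, norm_sub_sq_real, real_inner_smul_right, norm_smul, mul_pow,
      Real.norm_eq_abs, sq_abs] at h2
    linarith
  rcases eq_or_ne p 0 with rfl | hp0
  · simp
  have hN : 0 < ‖p‖ ^ 2 := by positivity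
  -- Compare `p` with the apex, which gives `0 ≤ ⟪x, p⟫`, then with the best multiple of `p` on its
  -- own ray.
  have h0 := key 0 le_rfl
  have ha : 0 ≤ inner ℝ x p / ‖p‖ ^ 2 := div_nonneg (by linarith) hN.le
  have h1 := key _ ha
  have e : inner ℝ x p = inner ℝ x p / ‖p‖ ^ 2 * ‖p‖ ^ 2 := by field_simp
  generalize inner ℝ x p / ‖p‖ ^ 2 = a at *
  rw [e] at h1 ⊢
  have h2 : (a - 1) ^ 2 * ‖p‖ ^ 2 ≤ 0 := by linarith
  have h3 : (a - 1) ^ 2 = 0 :=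
    le_antisymm (nonpos_of_mul_nonpos_left h2 hN) (sq_nonneg _)
  have h4 : a = 1 := by linarith [pow_eq_zero_iff (two_ne_zero) |>.mp h3]
  rw [h4, one_mul]

theorem IsNearest.norm_sub_eq_infDist {C : Set E} {x p : E} (hp : IsNearest C x p) :
    ‖x - p‖ = Metric.infDist x C := by
  rw [← dist_eq_norm]
  refine le_antisymm ((Metric.le_infDist ⟨p, hp.1⟩).2 fun q hq => ?_)
    (Metric.infDist_le_dist_of_mem hp.1)
  rw [dist_eq_norm, dist_eq_norm]
  exact hp.2 q hq

/-- Pythagoras for the nearest point in a cone. -/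
theorem IsNearest.norm_sq_eq {C : Set E} (hC : ∀ z ∈ C, ∀ a : ℝ, 0 ≤ a → a • z ∈ C)
    {x p : E} (hp : IsNearest C x p) : ‖p‖ ^ 2 = ‖x‖ ^ 2 - Metric.infDist x C ^ 2 := by
  rw [← hp.norm_sub_eq_infDist, norm_sub_sq_real, hp.inner_eq_norm_sq hC]
  ring

theorem smul_mem_circ {x : E} {θ : ℝ} {z : E} (hz : z ∈ circ x θ) {a : ℝ} (ha : 0 ≤ a) :
    a • z ∈ circ x θ := by
  rcases ha.eq_or_lt with rfl | ha
  · exact Or.inl (zero_smul _ _)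
  · rcases hz with rfl | hz
    · exact Or.inl (smul_zero _)
    · exact Or.inr (by rwa [InnerProductGeometry.angle_smul_left_of_pos _ _ ha])

/-- The planar estimate behind the bound for circular cones: if `(a, b)` has norm `N` and makes an
angle at most `θ` with the first axis, where `c = cos θ` and `s = sin θ`, and
`N ^ 2 ≤ t * a + r * b`, then `N ^ 2` is bounded by a quadratic form in `(t, r)`. -/
theorem sq_le_of_sector {t r a b N c s : ℝ} (hr : 0 ≤ r) (hc : 0 ≤ c) (hs : 0 ≤ s)
    (hcs : s ^ 2 + c ^ 2 = 1) (hab : a ^ 2 + b ^ 2 = N ^ 2) (ha : N * c ≤ a)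
    (hb : b ≤ N * s) (h : N ^ 2 ≤ t * a + r * b) :
    N ^ 2 ≤ t ^ 2 + 2 * (s * c) * (t * r) + s ^ 2 * r ^ 2 := by
  -- Coordinates along the boundary ray `(c, s)` and its inward normal `(s, -c)`; the sector lies in
  -- `Y ≥ 0`.
  set A := t * c + r * s with hA
  set B := t * s - r * c with hB
  set X := c * a + s * b with hX
  set Y := s * a - c * b with hY
  have hXY : X ^ 2 + Y ^ 2 = N ^ 2 := by
    rw [← hab, ← one_mul (a ^ 2 + b ^ 2), ← hcs]; simp only [hX, hY]; ring
  have hY0 : 0 ≤ Y := by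
    have := mul_le_mul_of_nonneg_left ha hs
    have := mul_le_mul_of_nonneg_left hb hc
    simp only [hY]; linarith
  have hAB : N ^ 2 ≤ A * X + B * Y := by
    have e : A * X + B * Y = (s ^ 2 + c ^ 2) * (t * a + r * b) := by
      simp only [hA, hB, hX, hY]; ring
    rw [e, hcs, one_mul]; exact h
  have hgoal : t ^ 2 + 2 * (s * c) * (t * r) + s ^ 2 * r ^ 2 = A ^ 2 + (t * s) ^ 2 := by
    rw [← mul_one (t ^ 2), ← hcs]; simp only [hA]; ring
  rw [hgoal]
  have of_sq : ∀ M : ℝ, 0 ≤ M → (N ^ 2) ^ 2 ≤ M * N ^ 2 → N ^ 2 ≤ M := by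
    intro M hM hle
    by_contra! hlt
    nlinarith
  -- If `B ≤ 0`, the normal term only hurts and `A ^ 2` suffices. Otherwise Cauchy–Schwarz gives `A
  -- ^ 2 + B ^ 2`, and `B ≤ t * s` since `r * c ≥ 0`.
  rcases le_total B 0 with hB0 | hB0
  · have h1 : N ^ 2 ≤ A * X := by linarith [mul_nonpos_of_nonpos_of_nonneg hB0 hY0]
    have h2 : (N ^ 2) ^ 2 ≤ A ^ 2 * N ^ 2 := calc
      (N ^ 2) ^ 2 ≤ (A * X) ^ 2 := pow_le_pow_left₀ (sq_nonneg _) h1 2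
      _ = A ^ 2 * X ^ 2 := mul_pow _ _ _
      _ ≤ A ^ 2 * N ^ 2 :=
        mul_le_mul_of_nonneg_left (by linarith [sq_nonneg Y]) (sq_nonneg _)
    linarith [of_sq _ (sq_nonneg A) h2, sq_nonneg (t * s)]
  · have h1 : (N ^ 2) ^ 2 ≤ (A ^ 2 + B ^ 2) * N ^ 2 := calc
      (N ^ 2) ^ 2 ≤ (A * X + B * Y) ^ 2 := pow_le_pow_left₀ (sq_nonneg _) hAB 2
      _ ≤ (A ^ 2 + B ^ 2) * (X ^ 2 + Y ^ 2) := by linarith [sq_nonneg (A * Y - B * X)]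
      _ = (A ^ 2 + B ^ 2) * N ^ 2 := by rw [hXY]
    have h2 : B ^ 2 ≤ (t * s) ^ 2 :=
      pow_le_pow_left₀ hB0 (by linarith [mul_nonneg hr hc]) 2
    linarith [of_sq _ (by positivity) h1]

theorem norm_sub_inner_smul_sq {u : E} (hu : ‖u‖ = 1) (x : E) :
    ‖x - inner ℝ u x • u‖ ^ 2 = ‖x‖ ^ 2 - inner ℝ u x ^ 2 := by
  rw [norm_sub_sq_real, real_inner_smul_right, norm_smul, hu, real_inner_comm, mul_one,
    Real.norm_eq_abs, sq_abs]
  ring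

/-- Cauchy–Schwarz applied only to the components orthogonal to `u`; this reduces the problem to the
plane. -/
theorem inner_le_mul_add_mul {u : E} (hu : ‖u‖ = 1) (x y : E) :
    inner ℝ x y ≤ inner ℝ u x * inner ℝ u y +
      ‖x - inner ℝ u x • u‖ * ‖y - inner ℝ u y • u‖ := by
  have h := real_inner_le_norm (x - inner ℝ u x • u) (y - inner ℝ u y • u)
  rw [inner_sub_left, inner_sub_right, inner_sub_right, real_inner_smul_left,
    real_inner_smul_right, real_inner_smul_left, real_inner_smul_right,
    real_inner_self_eq_norm_sq, hu, real_inner_comm u x] at h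
  linarith

theorem IsNearest.norm_sq_le_of_circ {u : E} (hu : ‖u‖ = 1) {θ : ℝ} (h0 : 0 ≤ θ)
    (h1 : θ ≤ Real.pi / 2) {x p : E} (hp : IsNearest (circ u θ) x p) :
    ‖p‖ ^ 2 ≤ inner ℝ u x ^ 2 +
      2 * (Real.sin θ * Real.cos θ) * (inner ℝ u x * ‖x - inner ℝ u x • u‖) +
      Real.sin θ ^ 2 * ‖x - inner ℝ u x • u‖ ^ 2 := by
  have hpi : θ ≤ Real.pi := by linarith [Real.pi_pos]
  have hc : 0 ≤ Real.cos θ := Real.cos_nonneg_of_mem_Icc ⟨by linarith [Real.pi_pos], h1⟩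
  have hs : 0 ≤ Real.sin θ := Real.sin_nonneg_of_nonneg_of_le_pi h0 hpi
  have hu0 : u ≠ 0 := by rintro rfl; simp at hu
  have ha : ‖p‖ * Real.cos θ ≤ inner ℝ u p := by
    have := (mem_circ_iff hu0 h0 hpi).1 hp.1
    rwa [hu, mul_one, real_inner_comm] at this
  have hsq := norm_sub_inner_smul_sq hu p
  refine sq_le_of_sector (a := inner ℝ u p) (b := ‖p - inner ℝ u p • u‖) (norm_nonneg _) hc hs
    (Real.sin_sq_add_cos_sq θ) (by rw [hsq]; ring) ha ?_ ?_
  · refine le_of_sq_le_sq ?_ (by positivity)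
    have := pow_le_pow_left₀ (by positivity) ha 2
    rw [mul_pow] at this
    rw [hsq, mul_pow, Real.sin_sq]
    linarith
  · rw [← hp.inner_eq_norm_sq fun z hz a ha => smul_mem_circ hz ha]
    exact inner_le_mul_add_mul hu x p

theorem circ_smul {x : E} {θ a : ℝ} (ha : 0 < a) : circ (a • x) θ = circ x θ := by
  ext z
  simp only [circ, InnerProductGeometry.angle_smul_right_of_pos _ _ ha]

end Projection

section Gaussian

variable {E : Type*} [NormedAddCommGroup E] [InnerProductSpace ℝ E] [FiniteDimensional ℝ E]
  [MeasurableSpace E] [BorelSpace E]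

theorem integrable_norm_sq_stdGaussian :
    Integrable (fun g : E => ‖g‖ ^ 2) (stdGaussian E) :=
  (IsGaussian.memLp_two_id (μ := stdGaussian E)).integrable_norm_pow (by norm_num)

theorem integrable_inner_sq_stdGaussian (u : E) :
    Integrable (fun g : E => inner ℝ u g ^ 2) (stdGaussian E) :=
  (IsGaussian.memLp_dual (stdGaussian E) (innerSL ℝ u) 2 (by norm_num)).integrable_sq

theorem integral_inner_sq_stdGaussian (u : E) :
    ∫ g, inner ℝ u g ^ 2 ∂(stdGaussian E) = ‖u‖ ^ 2 := by
  have h := variance_dual_stdGaussian (innerSL ℝ u)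
  rw [variance_of_integral_eq_zero (by fun_prop) (integral_strongDual_stdGaussian _),
    innerSL_apply_norm] at h
  simpa using h

theorem integral_norm_sq_stdGaussian :
    ∫ g, ‖g‖ ^ 2 ∂(stdGaussian E) = Module.finrank ℝ E := by
  have h (g : E) : ‖g‖ ^ 2 = ∑ i, inner ℝ (stdOrthonormalBasis ℝ E i) g ^ 2 := by
    simpa using ((stdOrthonormalBasis ℝ E).sum_sq_norm_inner_right g).symm
  simp_rw [h]
  rw [integral_finsetSum _ fun i _ => integrable_inner_sq_stdGaussian _]
  simp [integral_inner_sq_stdGaussian]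

/-- Odd functions have Gaussian mean zero. -/
theorem integral_eq_zero_of_odd_stdGaussian {f : E → ℝ} (hf : ∀ g, f (-g) = -f g) :
    ∫ g, f g ∂(stdGaussian E) = 0 := by
  have hmap := stdGaussian_map (LinearIsometryEquiv.neg ℝ (E := E))
  have h : ∫ g, f g ∂(stdGaussian E) = ∫ g, f (-g) ∂(stdGaussian E) := by
    conv_lhs => rw [← hmap]
    exact integral_map_equiv (LinearIsometryEquiv.neg ℝ (E := E)).toHomeomorph.toMeasurableEquiv f
  simp_rw [hf, integral_neg] at h
  linarith

theorem integrable_norm_sq_metricProj {C : Set E} (hne : C.Nonempty) (hcl : IsClosed C)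
    (hC : ∀ z ∈ C, ∀ a : ℝ, 0 ≤ a → a • z ∈ C) :
    Integrable (fun g => ‖metricProj C g‖ ^ 2) (stdGaussian E) := by
  have h (g : E) : ‖metricProj C g‖ ^ 2 = ‖g‖ ^ 2 - Metric.infDist g C ^ 2 :=
    (isNearest_metricProj hne hcl g).norm_sq_eq hC
  refine integrable_norm_sq_stdGaussian.mono' ?_ (.of_forall fun g => ?_)
  -- `metricProj` is a choice function, so measurability comes from the continuous distance to `C`.
  · simp_rw [h]
    exact ((continuous_norm.pow 2).sub
      ((Metric.continuous_infDist_pt C).pow 2)).aestronglyMeasurable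
  · rw [Real.norm_of_nonneg (sq_nonneg _), h]
    linarith [sq_nonneg (Metric.infDist g C)]

theorem statDim_circ_le {u : E} (hu : ‖u‖ = 1) {θ : ℝ} (h0 : 0 ≤ θ) (h1 : θ ≤ Real.pi / 2) :
    statDim (circ u θ) ≤ Module.finrank ℝ E * Real.sin θ ^ 2 + Real.cos θ ^ 2 := by
  have hpi : θ ≤ Real.pi := by linarith [Real.pi_pos]
  have hu0 : u ≠ 0 := by rintro rfl; simp at hu
  have hne : (circ u θ).Nonempty := ⟨0, Or.inl rfl⟩
  have hcl := isClosed_circ hu0 h0 hpi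
  have hi := integrable_norm_sq_metricProj hne hcl fun z hz a ha => smul_mem_circ hz ha
  have it := integrable_inner_sq_stdGaussian u
  have ir : Integrable (fun g : E => ‖g - inner ℝ u g • u‖ ^ 2) (stdGaussian E) := by
    simp_rw [norm_sub_inner_smul_sq hu]
    exact integrable_norm_sq_stdGaussian.sub it
  have itr : Integrable (fun g : E => inner ℝ u g * ‖g - inner ℝ u g • u‖) (stdGaussian E) := by
    refine (it.add ir).mono' (by fun_prop) (.of_forall fun g => ?_)
    rw [Real.norm_eq_abs, abs_le, Pi.add_apply]
    constructor <;>
      nlinarith [sq_nonneg (inner ℝ u g + ‖g - inner ℝ u g • u‖),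
        sq_nonneg (inner ℝ u g - ‖g - inner ℝ u g • u‖)]
  have hodd : ∫ g : E, inner ℝ u g * ‖g - inner ℝ u g • u‖ ∂(stdGaussian E) = 0 := by
    refine integral_eq_zero_of_odd_stdGaussian fun g => ?_
    rw [inner_neg_right, ← norm_neg (-g - _)]
    have : -(-g - -inner ℝ u g • u) = g - inner ℝ u g • u := by module
    rw [this, neg_mul]
  have hr : ∫ g : E, ‖g - inner ℝ u g • u‖ ^ 2 ∂(stdGaussian E) = Module.finrank ℝ E - 1 := by
    simp_rw [norm_sub_inner_smul_sq hu]
    rw [integral_sub integrable_norm_sq_stdGaussian it, integral_norm_sq_stdGaussian,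
      integral_inner_sq_stdGaussian, hu, one_pow]
  have i1 : Integrable (fun g : E => inner ℝ u g ^ 2 +
      2 * (Real.sin θ * Real.cos θ) * (inner ℝ u g * ‖g - inner ℝ u g • u‖)) (stdGaussian E) :=
    it.add (itr.const_mul _)
  calc statDim (circ u θ)
      ≤ ∫ g : E, (inner ℝ u g ^ 2 +
          2 * (Real.sin θ * Real.cos θ) * (inner ℝ u g * ‖g - inner ℝ u g • u‖) +
          Real.sin θ ^ 2 * ‖g - inner ℝ u g • u‖ ^ 2) ∂(stdGaussian E) :=
        integral_mono hi (i1.add (ir.const_mul _)) fun g =>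
          (isNearest_metricProj hne hcl g).norm_sq_le_of_circ hu h0 h1
    _ = 1 + Real.sin θ ^ 2 * (Module.finrank ℝ E - 1) := by
        rw [integral_add i1 (ir.const_mul _),
          integral_add it (itr.const_mul _), integral_const_mul, integral_const_mul, hodd, hr,
          integral_inner_sq_stdGaussian, hu]
        ring
    _ = Module.finrank ℝ E * Real.sin θ ^ 2 + Real.cos θ ^ 2 := by
        rw [Real.cos_sq']; ring

end Gaussian

end ConicGeometry

theorem mainTheorem5 (n : ℕ) (x₀ : EuclideanSpace ℝ (Fin n)) (hx₀ : x₀ ≠ 0)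
    (θ : ℝ) (hθ₀ : 0 ≤ θ) (hθ₁ : θ ≤ Real.pi / 2) :
    Integrable (fun g => ‖ConicGeometry.metricProj (ConicGeometry.circ x₀ θ) g‖ ^ 2)
        (stdGaussian (EuclideanSpace ℝ (Fin n))) ∧
      ConicGeometry.statDim (ConicGeometry.circ x₀ θ) ≤ n * Real.sin θ ^ 2 + 2 := by
  refine ⟨ConicGeometry.integrable_norm_sq_metricProj ⟨0, Or.inl rfl⟩
    (ConicGeometry.isClosed_circ hx₀ hθ₀ (by linarith [Real.pi_pos]))
    fun z hz a ha => ConicGeometry.smul_mem_circ hz ha, ?_⟩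
  have hu : ‖‖x₀‖⁻¹ • x₀‖ = 1 := by
    rw [norm_smul, norm_inv, norm_norm, inv_mul_cancel₀ (norm_ne_zero_iff.2 hx₀)]
  have h := ConicGeometry.statDim_circ_le hu hθ₀ hθ₁
  rw [ConicGeometry.circ_smul (inv_pos.2 (norm_pos_iff.2 hx₀)), finrank_euclideanSpace_fin] at h
  -- The additive term is really `cos² θ ≤ 1`; the constant 2 leaves slack.
  linarith [Real.cos_sq_le_one θ]
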